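/- Let $X$ be a compact complex manifold and let $(E,h)$ be a Hermitian holomorphic vector bundle over $X$ with Chern curvature $$R^{E}_{i\bar j\alpha\bar\beta}=-\frac{\partial^2h_{\alpha\bar\beta}}{\partial z^i\partial\bar z^j}+h^{\gamma\bar\delta}\frac{\partial h_{\alpha\bar\delta}}{\partial z^i}\frac{\partial h_{\gamma\bar\beta}}{\partial\bar z^j}$$ in local holomorphic coordinates and local holomorphic frames. A Hermitian holomorphic vector bundle $(E,h)$ over a complex manifold $X$ is called RC-positive if for every $q\in X$ and every nonzero $v\in E_q$ there is some nonzero $u\in T_qX$ with $R^{E}(u,\bar u,v,\bar v)>0$. Let $\mathbb P(E)$ be the projective bundle whose points are the pairs $(x,\ell)$ of a point $x\in X$ and a complex line $\ell\subset E_x$, with projection $\pi:\mathbb P(E)\to X$, and let $\mathcal O_{E^*}(-1)\subset\pi^*E$ be the tautological line bundle over $\mathbb P(E)$, whose fibre at $(x,\ell)$ is the line $\ell$, with the Hermitian metric induced by $h$ (the restriction of $h_x$ to $\ell$). If $(E,h)$ is RC-positive over $X$, then $\mathcal O_{E^*}(-1)$ with its induced metric is an RC-positive line bundle over $\mathbb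 P(E)$. -/

import Mathlib

open Bundle
open scoped Manifold ContDiff Topology LinearAlgebra.Projectivization

set_option linter.unusedSectionVars false

noncomputable section

namespace RCPositivity

/-! ### Wirtinger derivatives -/

section Wirtinger

/-- The directional Wirtinger derivative `∂_u f = ∑ u^i ∂f/∂z^i` of a (real differentiable)
function `f` on a complex vector space. -/
def wirtinger {V : Type*} [NormedAddCommGroup V] [NormedSpace ℂ V]
    (f : V → ℂ) (u : V) (z : V) : ℂ :=
  (fderiv ℝ f z u - Complex.I * fderiv ℝ f z (Complex.I • u)) / 2

/-- The conjugate directional Wirtinger derivative `∂_ū f = ∑ conj(u^i) ∂f/∂z̄^i`. -/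
def wirtingerBar {V : Type*} [NormedAddCommGroup V] [NormedSpace ℂ V]
    (f : V → ℂ) (u : V) (z : V) : ℂ :=
  (fderiv ℝ f z u + Complex.I * fderiv ℝ f z (Complex.I • u)) / 2

end Wirtinger

/-! ### Hermitian holomorphic vector bundles, Chern curvature, RC-positivity

A complex manifold `X` is a manifold modelled on a complex normed space `V` with holomorphic
(that is, complex analytic) transition maps, a holomorphic vector bundle over it is a vector bundle
with fibre `F` whose transition functions are holomorphic. -/

/-- A smooth Hermitian metric on a holomorphic vector bundle `E → X`. The form is linear in the
first and conjugate linear in the second variable, and its coefficients with respect to every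
holomorphic chart of `X` and every holomorphic local frame of `E` from the atlases are smooth
in the real sense. -/
structure HermitianMetric (V : Type*) [NormedAddCommGroup V] [NormedSpace ℂ V]
    {X : Type*} [TopologicalSpace X] [ChartedSpace V X] [IsManifold 𝓘(ℂ, V) ω X]
    (F : Type*) [NormedAddCommGroup F] [NormedSpace ℂ F]
    (E : X → Type*) [∀ x, AddCommGroup (E x)] [∀ x, Module ℂ (E x)]
    [TopologicalSpace (TotalSpace F E)] [∀ x, TopologicalSpace (E x)] [FiberBundle F E]
    [VectorBundle ℂ F E] [ContMDiffVectorBundle ω F E 𝓘(ℂ, V)] where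
  /-- the scalar product on the fibre over `x` -/
  form : ∀ x, E x →ₗ[ℂ] E x →ₗ⋆[ℂ] ℂ
  conj_form : ∀ x (v w : E x), (starRingEnd ℂ) (form x v w) = form x w v
  form_pos : ∀ x (v : E x), v ≠ 0 → 0 < (form x v v).re
  contDiffOn_form : ∀ φ ∈ atlas V X, ∀ (e : Trivialization F (π F E)) [MemTrivializationAtlas e]
    (a b : F), ContDiffOn ℝ ∞
      (fun z : V => form (φ.symm z) (e.symm (φ.symm z) a) (e.symm (φ.symm z) b))
      (φ.target ∩ φ.symm ⁻¹' e.baseSet)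

namespace HermitianMetric

variable {V : Type*} [NormedAddCommGroup V] [NormedSpace ℂ V]
    {X : Type*} [TopologicalSpace X] [ChartedSpace V X] [IsManifold 𝓘(ℂ, V) ω X]
    {F : Type*} [NormedAddCommGroup F] [NormedSpace ℂ F]
    {E : X → Type*} [∀ x, AddCommGroup (E x)] [∀ x, Module ℂ (E x)]
    [TopologicalSpace (TotalSpace F E)] [∀ x, TopologicalSpace (E x)] [FiberBundle F E]
    [VectorBundle ℂ F E] [ContMDiffVectorBundle ω F E 𝓘(ℂ, V)]

/-- The function `z ↦ h(a, b)` in the preferred holomorphic coordinates `z` around `x₀`, where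
`a, b : F` are regarded as local holomorphic sections of `E` that are constant in the preferred
trivialization around `x₀`. For members `a = b_α`, `b = b_β` of a basis of `F` this is the
coefficient `h_{α β̄}`. -/
def localForm (h : HermitianMetric V F E) (x₀ : X) (a b : F) (z : V) : ℂ :=
  h.form ((chartAt V x₀).symm z)
    ((trivializationAt F E x₀).symm ((chartAt V x₀).symm z) a)
    ((trivializationAt F E x₀).symm ((chartAt V x₀).symm z) b)

variable [FiniteDimensional ℂ F]

/-- The matrix `(h_{α β̄})` at `x₀` in the local holomorphic frame given by a basis of `F`. -/
def gramMatrix (h : HermitianMetric V F E) (x₀ : X) :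
    Matrix (Fin (Module.finrank ℂ F)) (Fin (Module.finrank ℂ F)) ℂ :=
  Matrix.of fun α β =>
    h.localForm x₀ (Module.finBasis ℂ F α) (Module.finBasis ℂ F β) (chartAt V x₀ x₀)

/-- The Chern curvature `R(u₁, ū₂, v₁, v̄₂)` at `x₀`, that is, the contraction of
`R_{i j̄ α β̄} = - ∂²h_{α β̄}/∂z^i∂z̄^j + h^{γ δ̄} ∂h_{α δ̄}/∂z^i ∂h_{γ β̄}/∂z̄^j`
with `u₁^i conj(u₂^j) v₁^α conj(v₂^β)`. Here `h^{γ δ̄}` is defined by `h^{γ δ̄} h_{β δ̄} = δ^γ_β`, so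
it is the entry `(δ, γ)` of the inverse of the matrix `(h_{α β̄})`. -/
def chernCurvature (h : HermitianMetric V F E) (x₀ : X) (u₁ u₂ : TangentSpace 𝓘(ℂ, V) x₀)
    (v₁ v₂ : E x₀) : ℂ :=
  let b := Module.finBasis ℂ F
  let z₀ : V := chartAt V x₀ x₀
  let a₁ : F := (trivializationAt F E x₀ ⟨x₀, v₁⟩).2
  let a₂ : F := (trivializationAt F E x₀ ⟨x₀, v₂⟩).2
  let secondOrder : ℂ := -wirtinger (wirtingerBar (h.localForm x₀ a₁ a₂) u₂) u₁ z₀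
  let firstOrder : ℂ := ∑ γ, ∑ δ, (h.gramMatrix x₀)⁻¹ δ γ *
    wirtinger (h.localForm x₀ a₁ (b δ)) u₁ z₀ * wirtingerBar (h.localForm x₀ (b γ) a₂) u₂ z₀
  secondOrder + firstOrder

/-- RC-positivity at a point `x`: for each nonzero `v ∈ E_x` there is some nonzero `u ∈ T_x X` with
`R(u, ū, v, v̄) > 0` (this number is real). -/
def IsRCPositiveAt (h : HermitianMetric V F E) (x : X) : Prop :=
  ∀ v : E x, v ≠ 0 → ∃ u : TangentSpace 𝓘(ℂ, V) x, u ≠ 0 ∧ 0 < (h.chernCurvature x u u v v).re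

/-- `(E, h)` is RC-positive if it is RC-positive at every point. -/
def IsRCPositive (h : HermitianMetric V F E) : Prop :=
  ∀ x, h.IsRCPositiveAt x

end HermitianMetric

/-! ### The projective bundle of lines -/

/-- The projective bundle `ℙ(E)`: its points are the pairs of a point `x` and a line in `E_x`. -/
structure ProjBundle (V : Type*) {X : Type*} (F : Type*) (E : X → Type*)
    [∀ x, AddCommGroup (E x)] [∀ x, Module ℂ (E x)] where
  /-- the image of the point under the projection `ℙ(E) → X` -/
  base : X
  /-- the line in the fibre over `base` -/
  line : ℙ ℂ (E base)

/-- The model space `ℂ^{r-1}` of the fibres `ℙ^{r-1}` of `ℙ(E)`, where `r = dim F`. -/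
abbrev FibreModel (F : Type*) [NormedAddCommGroup F] [NormedSpace ℂ F] : Type :=
  EuclideanSpace ℂ (Fin (Module.finrank ℂ F - 1))

/-- The data that determine a standard chart of `ℙ(E)`: a chart `φ` of `X`, a local trivialization
`e` of `E` and linear coordinates `ψ = (W₀, (W₁, …, W_{r-1}))` of the model fibre. -/
structure ChartIndex (V : Type*) [NormedAddCommGroup V] [NormedSpace ℂ V]
    {X : Type*} [TopologicalSpace X] [ChartedSpace V X]
    (F : Type*) [NormedAddCommGroup F] [NormedSpace ℂ F]
    (E : X → Type*) [∀ x, AddCommGroup (E x)] [∀ x, Module ℂ (E x)]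
    [TopologicalSpace (TotalSpace F E)] [∀ x, TopologicalSpace (E x)] [FiberBundle F E] where
  φ : OpenPartialHomeomorph X V
  φ_mem : φ ∈ atlas V X
  e : Trivialization F (π F E)
  e_mem : MemTrivializationAtlas e
  ψ : F ≃L[ℂ] ℂ × FibreModel F

attribute [instance] ChartIndex.e_mem

lemma rep_mk {W : Type*} [AddCommGroup W] [Module ℂ W] (v : W) (hv : v ≠ 0) :
    ∃ a : ℂ, a ≠ 0 ∧ (Projectivization.mk ℂ v hv).rep = a • v := by
  obtain ⟨a, ha⟩ := Projectivization.exists_smul_eq_mk_rep ℂ v hv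
  exact ⟨a, a.ne_zero, by rw [← ha]; rfl⟩

section Proj

variable {V : Type*} [NormedAddCommGroup V] [NormedSpace ℂ V]
    {X : Type*} [TopologicalSpace X] [ChartedSpace V X]
    {F : Type*} [NormedAddCommGroup F] [NormedSpace ℂ F]
    {E : X → Type*} [∀ x, AddCommGroup (E x)] [∀ x, Module ℂ (E x)]
    [TopologicalSpace (TotalSpace F E)] [∀ x, TopologicalSpace (E x)] [FiberBundle F E]
    [VectorBundle ℂ F E]

namespace ChartIndex

variable (c : ChartIndex V F E)

/-- The homogeneous coordinates `(W₀, (W₁, …, W_{r-1}))` of a vector of `E_x`. -/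
def hom (x : X) : E x →ₗ[ℂ] ℂ × FibreModel F :=
  c.ψ.toLinearEquiv.toLinearMap ∘ₗ c.e.linearMapAt ℂ x

/-- The vector of `E_x` with homogeneous coordinates `(1, w)`. -/
def lift (x : X) (w : FibreModel F) : E x :=
  c.e.symm x (c.ψ.symm (1, w))

lemma hom_lift {x : X} (hx : x ∈ c.e.baseSet) (w : FibreModel F) :
    c.hom x (c.lift x w) = (1, w) := by
  simp [hom, lift, -Trivialization.coe_linearMapAt_of_mem, Trivialization.linearMapAt_symm, hx]

lemma hom_injective {x : X} (hx : x ∈ c.e.baseSet) : Function.Injective (c.hom x) := by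
  intro v w hvw
  have h1 : c.e.linearMapAt ℂ x v = c.e.linearMapAt ℂ x w := c.ψ.injective hvw
  rw [← c.e.symm_linearMapAt (R := ℂ) hx v, h1, c.e.symm_linearMapAt hx]

lemma lift_ne_zero {x : X} (hx : x ∈ c.e.baseSet) (w : FibreModel F) : c.lift x w ≠ 0 := by
  intro h
  have := c.hom_lift hx w
  rw [h, map_zero] at this
  simpa using congrArg Prod.fst this

lemma eq_smul_lift {x : X} (hx : x ∈ c.e.baseSet) {v : E x} (hv : (c.hom x v).1 ≠ 0) :
    v = (c.hom x v).1 • c.lift x ((c.hom x v).1⁻¹ • (c.hom x v).2) := by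
  apply c.hom_injective hx
  rw [map_smul, c.hom_lift hx]
  ext1
  · simp
  · simp [smul_smul, hv]

end ChartIndex

lemma ProjBundle.nonempty_of_chartIndex (c : ChartIndex V F E) (z : V) :
    Nonempty (ProjBundle V F E) :=
  ⟨⟨c.φ.symm z, Projectivization.mk ℂ
    ((trivializationAt F E (c.φ.symm z)).symm (c.φ.symm z) (c.ψ.symm (1, 0))) (by
      let c' : ChartIndex V F E :=
        ⟨c.φ, c.φ_mem, trivializationAt F E (c.φ.symm z), inferInstance, c.ψ⟩
      exact c'.lift_ne_zero (FiberBundle.mem_baseSet_trivializationAt' _) 0)⟩⟩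

namespace ChartIndex

variable (c c' : ChartIndex V F E)

open scoped Classical in
/-- The inverse of a standard chart: `(z, w)` goes to the line spanned by the vector with
homogeneous coordinates `(1, w)` over the point with coordinates `z` (an arbitrary value is
taken where this makes no sense). -/
def invFun (y : V × FibreModel F) : ProjBundle V F E :=
  if h : c.lift (c.φ.symm y.1) y.2 ≠ 0 then
    ⟨c.φ.symm y.1, Projectivization.mk ℂ (c.lift (c.φ.symm y.1) y.2) h⟩
  else Classical.choice (ProjBundle.nonempty_of_chartIndex c y.1)

/-- The domain of a standard chart: the lines over `φ.source ∩ e.baseSet` with `W₀ ≠ 0`. -/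
def source : Set (ProjBundle V F E) :=
  {p | p.base ∈ c.φ.source ∧ p.base ∈ c.e.baseSet ∧ (c.hom p.base p.line.rep).1 ≠ 0}

/-- The inhomogeneous coordinates `w = (W₁ / W₀, …, W_{r-1} / W₀)` of a line. -/
def affine (p : ProjBundle V F E) : FibreModel F :=
  (c.hom p.base p.line.rep).1⁻¹ • (c.hom p.base p.line.rep).2

lemma mk_mem_source {x : X} {v : E x} (hv : v ≠ 0) :
    (⟨x, Projectivization.mk ℂ v hv⟩ : ProjBundle V F E) ∈ c.source ↔
      x ∈ c.φ.source ∧ x ∈ c.e.baseSet ∧ (c.hom x v).1 ≠ 0 := by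
  obtain ⟨a, ha, h⟩ := rep_mk v hv
  simp [source, h, ha]

lemma affine_mk {x : X} {v : E x} (hv : v ≠ 0) :
    c.affine ⟨x, Projectivization.mk ℂ v hv⟩ = (c.hom x v).1⁻¹ • (c.hom x v).2 := by
  obtain ⟨a, ha, h⟩ := rep_mk v hv
  simp only [affine, h, map_smul, Prod.smul_fst, Prod.smul_snd, smul_smul]
  congr 1
  rw [smul_eq_mul]
  field_simp

lemma invFun_of_mem {y : V × FibreModel F} (hy : c.φ.symm y.1 ∈ c.e.baseSet) :
    c.invFun y = ⟨c.φ.symm y.1,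
      Projectivization.mk ℂ (c.lift (c.φ.symm y.1) y.2) (c.lift_ne_zero hy y.2)⟩ := by
  unfold invFun
  rw [dif_pos (c.lift_ne_zero hy y.2)]

lemma mk_lift_affine {p : ProjBundle V F E} (hp : p ∈ c.source) :
    Projectivization.mk ℂ (c.lift p.base (c.affine p)) (c.lift_ne_zero hp.2.1 _) = p.line := by
  conv_rhs => rw [← p.line.mk_rep]
  rw [Projectivization.mk_eq_mk_iff']
  refine ⟨(c.hom p.base p.line.rep).1⁻¹, ?_⟩
  rw [inv_smul_eq_iff₀ hp.2.2]
  exact c.eq_smul_lift hp.2.1 hp.2.2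

/-- The standard chart `(x, [v]) ↦ (φ x, (W₁ / W₀, …, W_{r-1} / W₀))` of `ℙ(E)`. -/
def chart : PartialEquiv (ProjBundle V F E) (V × FibreModel F) where
  toFun p := (c.φ p.base, c.affine p)
  invFun := c.invFun
  source := c.source
  target := {y | y.1 ∈ c.φ.target ∧ c.φ.symm y.1 ∈ c.e.baseSet}
  map_source' p hp := ⟨c.φ.map_source hp.1, by
    change c.φ.symm (c.φ p.base) ∈ _
    rw [c.φ.left_inv hp.1]; exact hp.2.1⟩
  map_target' y hy := by
    rw [c.invFun_of_mem hy.2, c.mk_mem_source, c.hom_lift hy.2]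
    exact ⟨c.φ.map_target hy.1, hy.2, one_ne_zero⟩
  left_inv' p hp := by
    obtain ⟨x, l⟩ := p
    have hx : c.φ.symm (c.φ x) = x := c.φ.left_inv hp.1
    rw [c.invFun_of_mem (by rw [hx]; exact hp.2.1)]
    have key : ∀ (x' : X) (hx' : x' = x) (h : c.lift x' (c.affine ⟨x, l⟩) ≠ 0),
        (⟨x', Projectivization.mk ℂ (c.lift x' (c.affine ⟨x, l⟩)) h⟩ : ProjBundle V F E) =
          ⟨x, l⟩ := by
      rintro _ rfl h
      exact congrArg (ProjBundle.mk _) (c.mk_lift_affine hp)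
    exact key _ hx _
  right_inv' y hy := by
    rw [c.invFun_of_mem hy.2, c.affine_mk, c.hom_lift hy.2, c.φ.right_inv hy.1]
    simp

/-- The transition function of homogeneous coordinates: `(z, w)` goes to the homogeneous
coordinates for `c'` of the vector with homogeneous coordinates `(1, w)` for `c`. -/
def trans (y : V × FibreModel F) : ℂ × FibreModel F :=
  c'.ψ (c.e.coordChangeL ℂ c'.e (c.φ.symm y.1) (c.ψ.symm (1, y.2)))

/-- The domain where `trans` is meaningful. -/
def transDomain : Set (V × FibreModel F) :=
  {y | y.1 ∈ c.φ.target ∧ c.φ.symm y.1 ∈ c.e.baseSet ∩ c'.e.baseSet}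

lemma hom_lift_eq_trans {y : V × FibreModel F}
    (hy : c.φ.symm y.1 ∈ c.e.baseSet ∩ c'.e.baseSet) :
    c'.hom (c.φ.symm y.1) (c.lift (c.φ.symm y.1) y.2) = c.trans c' y := by
  simp only [hom, lift, trans, c.e.coordChangeL_apply c'.e hy]
  simp [hy.2]

lemma isOpen_transDomain : IsOpen (c.transDomain c') := by
  have h1 : IsOpen (c.φ.target ∩ c.φ.symm ⁻¹' (c.e.baseSet ∩ c'.e.baseSet)) :=
    c.φ.isOpen_inter_preimage_symm (c.e.open_baseSet.inter c'.e.open_baseSet)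
  exact h1.preimage continuous_fst

lemma source_trans_eq : (c.chart.symm.trans c'.chart).source =
    (c.transDomain c' ∩ {y | c.φ.symm y.1 ∈ c'.φ.source}) ∩ {y | (c.trans c' y).1 ≠ 0} := by
  ext y
  constructor
  · rintro ⟨hy1, hy2⟩
    change c.invFun y ∈ c'.source at hy2
    rw [c.invFun_of_mem hy1.2, c'.mk_mem_source] at hy2
    refine ⟨⟨⟨hy1.1, hy1.2, hy2.2.1⟩, hy2.1⟩, ?_⟩
    have := hy2.2.2
    rwa [c.hom_lift_eq_trans c' ⟨hy1.2, hy2.2.1⟩] at this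
  · rintro ⟨⟨⟨h1, h2, h3⟩, h4⟩, h5⟩
    refine ⟨⟨h1, h2⟩, ?_⟩
    change c.invFun y ∈ c'.source
    rw [c.invFun_of_mem h2, c'.mk_mem_source]
    refine ⟨h4, h3, ?_⟩
    rwa [c.hom_lift_eq_trans c' ⟨h2, h3⟩]

variable [IsManifold 𝓘(ℂ, V) ω X] [ContMDiffVectorBundle ω F E 𝓘(ℂ, V)]

lemma contDiffOn_trans : ContDiffOn ℂ ω (c.trans c') (c.transDomain c') := by
  have h1 : ContMDiffOn 𝓘(ℂ, V) 𝓘(ℂ, F →L[ℂ] F) ω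
      (fun z : V => (c.e.coordChangeL ℂ c'.e (c.φ.symm z) : F →L[ℂ] F))
      (c.φ.target ∩ c.φ.symm ⁻¹' (c.e.baseSet ∩ c'.e.baseSet)) :=
    (contMDiffOn_coordChangeL c.e c'.e).comp
      ((contMDiffOn_symm_of_mem_maximalAtlas
        (IsManifold.subset_maximalAtlas c.φ_mem)).mono Set.inter_subset_left)
      (fun z hz => hz.2)
  have h2 := contMDiffOn_iff_contDiffOn.1 h1
  have h3 : ContDiffOn ℂ ω
      (fun y : V × FibreModel F => (c.e.coordChangeL ℂ c'.e (c.φ.symm y.1) : F →L[ℂ] F))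
      (c.transDomain c') := h2.comp contDiff_fst.contDiffOn (fun y hy => hy)
  have h4 : ContDiff ℂ ω (fun y : V × FibreModel F => c.ψ.symm ((1 : ℂ), y.2)) :=
    c.ψ.symm.contDiff.comp (contDiff_const.prodMk contDiff_snd)
  exact c'.ψ.contDiff.comp_contDiffOn (h3.clm_apply h4.contDiffOn)

lemma isOpen_source_trans : IsOpen (c.chart.symm.trans c'.chart).source := by
  rw [source_trans_eq]
  have h0 : IsOpen (c.transDomain c' ∩ {y | c.φ.symm y.1 ∈ c'.φ.source}) := by
    have h1 : IsOpen (c.φ.target ∩ c.φ.symm ⁻¹' c'.φ.source) :=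
      c.φ.isOpen_inter_preimage_symm c'.φ.open_source
    have h2 := (c.isOpen_transDomain c').inter
      (h1.preimage (continuous_fst (X := V) (Y := FibreModel F)))
    convert h2 using 1
    ext y
    simp only [Set.mem_inter_iff, transDomain, Set.mem_ofPred_eq, Set.mem_preimage]
    tauto
  have h3 : ContinuousOn (fun y => (c.trans c' y).1)
      (c.transDomain c' ∩ {y | c.φ.symm y.1 ∈ c'.φ.source}) :=
    (continuous_fst.comp_continuousOn (c.contDiffOn_trans c').continuousOn).mono
      Set.inter_subset_left
  exact h3.isOpen_inter_preimage h0 isOpen_compl_singleton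

lemma contDiffOn_chart_trans : ContDiffOn ℂ ω (c.chart.symm.trans c'.chart)
    (c.chart.symm.trans c'.chart).source := by
  rw [source_trans_eq]
  have h0 := c.contDiffOn_trans c'
  have h1 : ContDiffOn ℂ ω (fun z : V => c'.φ (c.φ.symm z))
      (c.φ.target ∩ c.φ.symm ⁻¹' c'.φ.source) := by
    rw [← contMDiffOn_iff_contDiffOn]
    exact (contMDiffOn_of_mem_maximalAtlas (IsManifold.subset_maximalAtlas c'.φ_mem)).comp
      ((contMDiffOn_symm_of_mem_maximalAtlas
        (IsManifold.subset_maximalAtlas c.φ_mem)).mono Set.inter_subset_left)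
      (fun z hz => hz.2)
  have h2 : ContDiffOn ℂ ω (fun y : V × FibreModel F => c'.φ (c.φ.symm y.1))
      ((c.transDomain c' ∩ {y | c.φ.symm y.1 ∈ c'.φ.source}) ∩ {y | (c.trans c' y).1 ≠ 0}) :=
    h1.comp contDiff_fst.contDiffOn (fun y hy => ⟨hy.1.1.1, hy.1.2⟩)
  have h3 : ContDiffOn ℂ ω (fun y => (c.trans c' y).1⁻¹ • (c.trans c' y).2)
      ((c.transDomain c' ∩ {y | c.φ.symm y.1 ∈ c'.φ.source}) ∩ {y | (c.trans c' y).1 ≠ 0}) := by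
    have h4 := h0.mono (Set.inter_subset_left.trans Set.inter_subset_left :
      ((c.transDomain c' ∩ {y | c.φ.symm y.1 ∈ c'.φ.source}) ∩ {y | (c.trans c' y).1 ≠ 0}) ⊆ _)
    exact (h4.fst.inv (fun y hy => hy.2)).smul h4.snd
  refine (h2.prodMk h3).congr ?_
  rintro y ⟨⟨⟨hy1, hy2, hy3⟩, hy4⟩, hy5⟩
  change (c'.φ (c.invFun y).base, c'.affine (c.invFun y)) = _
  rw [c.invFun_of_mem hy2, c'.affine_mk, c.hom_lift_eq_trans c' ⟨hy2, hy3⟩]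

end ChartIndex

variable [FiniteDimensional ℂ F]

lemma exists_coordinates {f : F} (hf : f ≠ 0) : ∃ ψ : F ≃L[ℂ] ℂ × FibreModel F, (ψ f).1 ≠ 0 := by
  have hpos : 0 < Module.finrank ℂ F := Module.finrank_pos_iff_exists_ne_zero.2 ⟨f, hf⟩
  have hdim : Module.finrank ℂ F = Module.finrank ℂ (ℂ × FibreModel F) := by
    rw [Module.finrank_prod, Module.finrank_self, finrank_euclideanSpace_fin]
    omega
  let ψ₀ : F ≃L[ℂ] ℂ × FibreModel F := ContinuousLinearEquiv.ofFinrankEq hdim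
  have h0 : ψ₀ f ≠ 0 := by simpa using hf
  have h1 : ((1, 0) : ℂ × FibreModel F) ≠ 0 := by simp
  obtain ⟨A, hA⟩ := SeparatingDual.exists_continuousLinearEquiv_apply_eq (R := ℂ) h0 h1
  exact ⟨ψ₀.trans A, by simp [hA]⟩

lemma ProjBundle.exists_chartIndex (p : ProjBundle V F E) :
    ∃ c : ChartIndex V F E, c.φ = chartAt V p.base ∧ c.e = trivializationAt F E p.base ∧
      p ∈ c.source := by
  have hx := FiberBundle.mem_baseSet_trivializationAt' (F := F) (E := E) p.base
  have hf : (trivializationAt F E p.base).linearMapAt ℂ p.base p.line.rep ≠ 0 := by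
    intro h0
    apply p.line.rep_nonzero
    rw [← (trivializationAt F E p.base).symmₗ_linearMapAt (R := ℂ) hx p.line.rep, h0, map_zero]
  obtain ⟨ψ, hψ⟩ := exists_coordinates hf
  exact ⟨⟨chartAt V p.base, chart_mem_atlas V p.base, trivializationAt F E p.base,
    inferInstance, ψ⟩, rfl, rfl, mem_chart_source V p.base, hx, hψ⟩

/-- The preferred standard chart around a point of `ℙ(E)`, built from the preferred chart of `X`,
the preferred trivialization of `E` and some linear coordinates with `W₀ ≠ 0` on the line. -/
def ProjBundle.chartIndexAt (p : ProjBundle V F E) : ChartIndex V F E :=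
  p.exists_chartIndex.choose

lemma ProjBundle.mem_source_chartIndexAt (p : ProjBundle V F E) : p ∈ p.chartIndexAt.source :=
  p.exists_chartIndex.choose_spec.2.2

variable [IsManifold 𝓘(ℂ, V) ω X] [ContMDiffVectorBundle ω F E 𝓘(ℂ, V)]

variable (V F E) in
/-- The standard charts of `ℙ(E)`. -/
def ProjBundle.chartedSpaceCore : ChartedSpaceCore (V × FibreModel F) (ProjBundle V F E) where
  atlas := Set.range ChartIndex.chart
  chartAt p := p.chartIndexAt.chart
  mem_chart_source p := p.mem_source_chartIndexAt
  chart_mem_atlas p := ⟨p.chartIndexAt, rfl⟩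
  open_source := by
    rintro _ _ ⟨c, rfl⟩ ⟨c', rfl⟩
    exact c.isOpen_source_trans c'
  continuousOn_toFun := by
    rintro _ _ ⟨c, rfl⟩ ⟨c', rfl⟩
    exact (c.contDiffOn_chart_trans c').continuousOn

/-- The topology of `ℙ(E)`, for which the standard charts are homeomorphisms onto open sets. -/
instance ProjBundle.instTopologicalSpace : TopologicalSpace (ProjBundle V F E) :=
  (ProjBundle.chartedSpaceCore V F E).toTopologicalSpace

instance ProjBundle.instChartedSpace :
    ChartedSpace (V × FibreModel F) (ProjBundle V F E) :=
  (ProjBundle.chartedSpaceCore V F E).toChartedSpace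

lemma ProjBundle.mem_atlas_iff (f : OpenPartialHomeomorph (ProjBundle V F E) (V × FibreModel F)) :
    f ∈ atlas (V × FibreModel F) (ProjBundle V F E) ↔
      ∃ c : ChartIndex V F E, f.toPartialEquiv = c.chart := by
  constructor
  · intro hf
    obtain ⟨_, ⟨e, rfl⟩, _, ⟨⟨c, rfl⟩, rfl⟩, rfl⟩ := hf
    exact ⟨c, rfl⟩
  · rintro ⟨c, hc⟩
    refine Set.mem_iUnion₂.2 ⟨c.chart, ⟨c, rfl⟩, ?_⟩
    exact OpenPartialHomeomorph.toPartialEquiv_injective hc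

/-- `ℙ(E)` is a complex manifold. -/
instance ProjBundle.instIsManifold :
    IsManifold 𝓘(ℂ, V × FibreModel F) ω (ProjBundle V F E) := by
  apply isManifold_of_contDiffOn
  intro e e' he he'
  obtain ⟨c, hc⟩ := (ProjBundle.mem_atlas_iff e).1 he
  obtain ⟨c', hc'⟩ := (ProjBundle.mem_atlas_iff e').1 he'
  have h := c.contDiffOn_chart_trans c'
  rw [← hc, ← hc'] at h
  simpa using h

/-! ### The tautological line bundle -/

variable (V F E) in
/-- The tautological line bundle `O_{E^*}(-1) → ℙ(E)`: its fibre over a line is the line itself,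
a subspace of `E_x`. -/
def Taut (p : ProjBundle V F E) : Type _ := p.line.submodule

instance Taut.instAddCommGroup (p : ProjBundle V F E) : AddCommGroup (Taut V F E p) :=
  inferInstanceAs (AddCommGroup p.line.submodule)

instance Taut.instModule (p : ProjBundle V F E) : Module ℂ (Taut V F E p) :=
  inferInstanceAs (Module ℂ p.line.submodule)

instance Taut.instTopologicalSpace (p : ProjBundle V F E) : TopologicalSpace (Taut V F E p) :=
  inferInstanceAs (TopologicalSpace p.line.submodule)

/-- A vector of the line `p`, as an element of the fibre of the tautological line bundle. -/
def Taut.mk (p : ProjBundle V F E) (v : E p.base) (hv : v ∈ p.line.submodule) : Taut V F E p :=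
  (⟨v, hv⟩ : p.line.submodule)

/-- The inclusion of the line `p` into the fibre of `E` that contains it. -/
def Taut.incl (p : ProjBundle V F E) : Taut V F E p →ₗ[ℂ] E p.base := p.line.submodule.subtype

lemma Taut.incl_injective (p : ProjBundle V F E) : Function.Injective (Taut.incl p) :=
  Subtype.val_injective

namespace ChartIndex

variable (c c' : ChartIndex V F E)

lemma lift_affine_mem {p : ProjBundle V F E} (hp : p ∈ c.source) :
    c.lift p.base (c.affine p) ∈ p.line.submodule := by
  rw [← c.mk_lift_affine hp, Projectivization.submodule_mk]
  exact Submodule.mem_span_singleton_self _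

open scoped Classical in
/-- The local holomorphic frame of the tautological line bundle over the domain of a standard
chart: at a line it takes the vector of the line with `W₀ = 1` (and it is `0` elsewhere). -/
def frame (p : ProjBundle V F E) : Taut V F E p :=
  if hp : p ∈ c.source then Taut.mk p (c.lift p.base (c.affine p)) (c.lift_affine_mem hp) else 0

lemma incl_frame {p : ProjBundle V F E} (hp : p ∈ c.source) :
    Taut.incl p (c.frame p) = c.lift p.base (c.affine p) := by
  rw [frame, dif_pos hp]; rfl

lemma hom_incl_frame {p : ProjBundle V F E} (hp : p ∈ c.source) :
    c.hom p.base (Taut.incl p (c.frame p)) = (1, c.affine p) := by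
  rw [c.incl_frame hp, c.hom_lift hp.2.1]

lemma eq_smul_frame {p : ProjBundle V F E} (hp : p ∈ c.source) (v : Taut V F E p) :
    v = (c.hom p.base (Taut.incl p v)).1 • c.frame p := by
  have hv : Taut.incl p v ∈ p.line.submodule := Subtype.property (p := (· ∈ p.line.submodule)) v
  rw [← c.mk_lift_affine hp, Projectivization.submodule_mk, Submodule.mem_span_singleton] at hv
  obtain ⟨a, ha⟩ := hv
  have h1 : v = a • c.frame p := by
    apply Taut.incl_injective
    rw [map_smul, c.incl_frame hp, ha]
  rw [h1, map_smul, map_smul, c.hom_incl_frame hp]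
  simp

/-- The local trivialization of the tautological line bundle over the domain of a standard
chart: it takes a vector of the line to its coordinate `W₀`. -/
def pretriv : Pretrivialization ℂ (π ℂ (Taut V F E)) where
  toFun v := (v.proj, (c.hom v.proj.base (Taut.incl v.proj v.snd)).1)
  invFun y := ⟨y.1, y.2 • c.frame y.1⟩
  source := TotalSpace.proj ⁻¹' c.source
  target := c.source ×ˢ Set.univ
  map_source' v hv := ⟨hv, Set.mem_univ _⟩
  map_target' y hy := hy.1
  left_inv' v hv := by
    obtain ⟨p, v⟩ := v
    exact congrArg (TotalSpace.mk p) (c.eq_smul_frame hv v).symm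
  right_inv' y hy := by
    refine Prod.ext rfl ?_
    simp only [map_smul, c.hom_incl_frame hy.1]
    simp
  open_target := (((ProjBundle.chartedSpaceCore V F E).open_source' ⟨c, rfl⟩)).prod isOpen_univ
  baseSet := c.source
  open_baseSet := (ProjBundle.chartedSpaceCore V F E).open_source' ⟨c, rfl⟩
  source_eq := rfl
  target_eq := rfl
  proj_toFun _ _ := rfl

lemma pretriv_symm {p : ProjBundle V F E} (hp : p ∈ c.source) (a : ℂ) :
    (c.pretriv : Pretrivialization ℂ (π ℂ (Taut V F E))).symm p a = a • c.frame p := by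
  have h1 := c.pretriv.mk_symm (b := p) hp a
  have h2 : c.pretriv.toPartialEquiv.symm (p, a) =
    (⟨p, a • c.frame p⟩ : TotalSpace ℂ (Taut V F E)) := rfl
  rw [h2] at h1
  exact eq_of_heq (TotalSpace.mk.inj h1).2

/-- The transition function of the tautological line bundle between two standard charts. -/
def ratio (p : ProjBundle V F E) : ℂ := (c.trans c' (c.chart p)).1

lemma ratio_eq {p : ProjBundle V F E} (hp : p ∈ c.source ∩ c'.source) :
    c.ratio c' p = (c'.hom p.base (Taut.incl p (c.frame p))).1 := by
  have hx : c.φ.symm (c.chart p).1 = p.base := c.φ.left_inv hp.1.1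
  rw [c.incl_frame hp.1, ratio, ← c.hom_lift_eq_trans c' (by rw [hx]; exact ⟨hp.1.2.1, hp.2.2.1⟩)]
  have key : ∀ x' : X, x' = p.base → (c'.hom x' (c.lift x' (c.affine p))).1 =
      (c'.hom p.base (c.lift p.base (c.affine p))).1 := by
    rintro _ rfl; rfl
  exact key _ hx

lemma contMDiffOn_ratio : ContMDiffOn 𝓘(ℂ, V × FibreModel F) 𝓘(ℂ, ℂ) ω (c.ratio c')
    (c.source ∩ c'.source) := by
  have h1 : ContMDiffOn 𝓘(ℂ, V × FibreModel F) 𝓘(ℂ, ℂ) ω (fun y => (c.trans c' y).1)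
      (c.transDomain c') := contMDiffOn_iff_contDiffOn.2 (c.contDiffOn_trans c').fst
  let f : OpenPartialHomeomorph (ProjBundle V F E) (V × FibreModel F) :=
    (ProjBundle.chartedSpaceCore V F E).openPartialHomeomorph c.chart ⟨c, rfl⟩
  have hf : f ∈ atlas (V × FibreModel F) (ProjBundle V F E) :=
    (ProjBundle.mem_atlas_iff f).2 ⟨c, rfl⟩
  have h2 : ContMDiffOn 𝓘(ℂ, V × FibreModel F) 𝓘(ℂ, V × FibreModel F) ω f f.source :=
    contMDiffOn_of_mem_maximalAtlas (IsManifold.subset_maximalAtlas hf)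
  refine h1.comp (h2.mono Set.inter_subset_left) ?_
  rintro p ⟨hp, hp'⟩
  have hx : c.φ.symm (c.φ p.base) = p.base := c.φ.left_inv hp.1
  refine ⟨c.φ.map_source hp.1, ?_⟩
  change c.φ.symm (c.φ p.base) ∈ _
  rw [hx]
  exact ⟨hp.2.1, hp'.2.1⟩

lemma contMDiffOn_ratioL : ContMDiffOn 𝓘(ℂ, V × FibreModel F) 𝓘(ℂ, ℂ →L[ℂ] ℂ) ω
    (fun p => c.ratio c' p • ContinuousLinearMap.id ℂ ℂ) (c.source ∩ c'.source) :=
  (c.contMDiffOn_ratio c').smul contMDiffOn_const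

lemma pretriv_coordChange {p : ProjBundle V F E} (hp : p ∈ c.source ∩ c'.source) (a : ℂ) :
    (c.ratio c' p • ContinuousLinearMap.id ℂ ℂ) a =
      (c'.pretriv ⟨p, c.pretriv.symm p a⟩).2 := by
  rw [c.pretriv_symm hp.1]
  change _ = (c'.hom p.base (Taut.incl p (a • c.frame p))).1
  rw [map_smul, map_smul, c.ratio_eq c' hp]
  simp [mul_comm]

lemma continuous_pretriv_fibre {p : ProjBundle V F E} (hp : p ∈ c.source) :
    Topology.IsInducing (c.pretriv ∘ (TotalSpace.mk p : Taut V F E p → TotalSpace ℂ (Taut V F E))) := by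
  have hincl : Continuous (Taut.incl p) :=
    continuous_subtype_val (p := fun v => v ∈ p.line.submodule)
  have h1 : Continuous (fun v : Taut V F E p => (p, (c.hom p.base (Taut.incl p v)).1)) := by
    refine continuous_const.prodMk (continuous_fst.comp (c.ψ.continuous.comp ?_))
    exact (c.e.continuousLinearMapAt ℂ p.base).continuous.comp hincl
  have h2 : Continuous (fun y : ProjBundle V F E × ℂ => y.2 • c.frame p) := by
    refine Continuous.subtype_mk (p := fun v => v ∈ p.line.submodule)
      (f := fun y : ProjBundle V F E × ℂ => Taut.incl p (y.2 • c.frame p)) ?_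
      (fun y => (y.2 • c.frame p : p.line.submodule).2)
    have h3 : (fun y : ProjBundle V F E × ℂ => Taut.incl p (y.2 • c.frame p)) =
        fun y => c.e.symmL ℂ p.base (y.2 • c.ψ.symm (1, c.affine p)) := by
      funext y
      rw [map_smul, map_smul, c.incl_frame hp, c.e.symmL_apply hp.2.1]
      rfl
    rw [h3]
    exact (c.e.symmL ℂ p.base).continuous.comp (continuous_snd.smul continuous_const)
  have h4 : Function.LeftInverse (fun y : ProjBundle V F E × ℂ => y.2 • c.frame p)
      (fun v : Taut V F E p => (p, (c.hom p.base (Taut.incl p v)).1)) :=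
    fun v => (c.eq_smul_frame hp v).symm
  exact (h4.isEmbedding h2 h1).isInducing

end ChartIndex

variable (V F E) in
/-- The local trivializations of the tautological line bundle. -/
def Taut.vectorPrebundle : VectorPrebundle ℂ ℂ (Taut V F E) where
  pretrivializationAtlas := Set.range ChartIndex.pretriv
  pretrivialization_linear' := by
    rintro _ ⟨c, rfl⟩
    constructor
    intro p hp
    exact ((LinearMap.fst ℂ ℂ (FibreModel F)) ∘ₗ c.hom p.base ∘ₗ Taut.incl p).isLinear
  pretrivializationAt p := p.chartIndexAt.pretriv
  mem_base_pretrivializationAt p := p.mem_source_chartIndexAt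
  pretrivialization_mem_atlas p := ⟨p.chartIndexAt, rfl⟩
  exists_coordChange := by
    rintro _ ⟨c, rfl⟩ _ ⟨c', rfl⟩
    exact ⟨fun p => c.ratio c' p • ContinuousLinearMap.id ℂ ℂ,
      (c.contMDiffOn_ratioL c').continuousOn, fun p hp a => c.pretriv_coordChange c' hp a⟩
  totalSpaceMk_isInducing p := p.chartIndexAt.continuous_pretriv_fibre p.mem_source_chartIndexAt

instance Taut.instIsContMDiff :
    (Taut.vectorPrebundle V F E).IsContMDiff 𝓘(ℂ, V × FibreModel F) ω where
  exists_contMDiffCoordChange := by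
    rintro _ ⟨c, rfl⟩ _ ⟨c', rfl⟩
    exact ⟨fun p => c.ratio c' p • ContinuousLinearMap.id ℂ ℂ,
      c.contMDiffOn_ratioL c', fun p hp a => c.pretriv_coordChange c' hp a⟩

instance Taut.instTopologicalSpaceTotalSpace : TopologicalSpace (TotalSpace ℂ (Taut V F E)) :=
  (Taut.vectorPrebundle V F E).totalSpaceTopology

instance Taut.instFiberBundle : FiberBundle ℂ (Taut V F E) :=
  (Taut.vectorPrebundle V F E).toFiberBundle

instance Taut.instVectorBundle : VectorBundle ℂ ℂ (Taut V F E) :=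
  (Taut.vectorPrebundle V F E).toVectorBundle

/-- The tautological line bundle is a holomorphic line bundle. -/
instance Taut.instContMDiffVectorBundle :
    ContMDiffVectorBundle ω ℂ (Taut V F E) 𝓘(ℂ, V × FibreModel F) :=
  (Taut.vectorPrebundle V F E).contMDiffVectorBundle _

lemma Taut.exists_chartIndex_of_mem (e : Trivialization ℂ (π ℂ (Taut V F E)))
    [he : MemTrivializationAtlas e] : ∃ c : ChartIndex V F E, e.toPretrivialization = c.pretriv := by
  obtain ⟨_, ⟨c, rfl⟩, h⟩ := he.out
  exact ⟨c, by rw [h]; rfl⟩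

namespace HermitianMetric

/-- The restriction of the Hermitian metric of `E` to the line `p`. -/
def tautForm (h : HermitianMetric V F E) (p : ProjBundle V F E) :
    Taut V F E p →ₗ[ℂ] Taut V F E p →ₗ⋆[ℂ] ℂ :=
  LinearMap.mk₂'ₛₗ (RingHom.id ℂ) (starRingEnd ℂ)
    (fun v w => h.form p.base (Taut.incl p v) (Taut.incl p w))
    (by intros; simp) (by intros; simp) (by intros; simp) (by intros; simp)

lemma tautForm_apply (h : HermitianMetric V F E) (p : ProjBundle V F E) (v w : Taut V F E p) :
    h.tautForm p v w = h.form p.base (Taut.incl p v) (Taut.incl p w) := rfl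

lemma tautForm_frame (h : HermitianMetric V F E) (c c' : ChartIndex V F E) (a b : ℂ)
    {y : V × FibreModel F} (hy : y ∈ c.chart.target) (hy' : c.chart.symm y ∈ c'.source) :
    h.tautForm (c.chart.symm y) (a • c'.frame _) (b • c'.frame _) =
      a * (starRingEnd ℂ) b * ((c.trans c' y).1⁻¹ * (starRingEnd ℂ) (c.trans c' y).1⁻¹ *
        h.form (c.φ.symm y.1) (c.lift (c.φ.symm y.1) y.2) (c.lift (c.φ.symm y.1) y.2)) := by
  set p := c.chart.symm y with hp
  have hpc : p ∈ c.source := c.chart.map_target hy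
  have hcy : c.chart p = y := c.chart.right_inv hy
  have hr : c.ratio c' p = (c.trans c' y).1 := by rw [ChartIndex.ratio, hcy]
  have hfr : c.frame p = (c.trans c' y).1 • c'.frame p := by
    rw [← hr, c.ratio_eq c' ⟨hpc, hy'⟩]
    exact c'.eq_smul_frame hy' _
  have ht : (c.trans c' y).1 ≠ 0 := by
    intro h0
    rw [h0, zero_smul] at hfr
    have h1 := c.hom_incl_frame hpc
    rw [hfr, map_zero, map_zero] at h1
    simpa using congrArg Prod.fst h1
  have hfr' : c'.frame p = (c.trans c' y).1⁻¹ • c.frame p := by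
    rw [hfr, smul_smul, inv_mul_cancel₀ ht, one_smul]
  have hinv : p = ⟨c.φ.symm y.1, Projectivization.mk ℂ (c.lift (c.φ.symm y.1) y.2)
      (c.lift_ne_zero hy.2 y.2)⟩ := c.invFun_of_mem hy.2
  have hform : h.tautForm p (c.frame p) (c.frame p) =
      h.form (c.φ.symm y.1) (c.lift (c.φ.symm y.1) y.2) (c.lift (c.φ.symm y.1) y.2) := by
    have haff : c.affine p = y.2 := congrArg Prod.snd hcy
    have hbase : p.base = c.φ.symm y.1 := congrArg ProjBundle.base hinv
    rw [h.tautForm_apply, c.incl_frame hpc, haff, hbase]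
  rw [← hform, hfr']
  simp only [map_smul, LinearMap.map_smulₛₗ, LinearMap.smul_apply, smul_eq_mul]
  ring

lemma contDiffOn_form_lift (h : HermitianMetric V F E) (c : ChartIndex V F E) :
    ContDiffOn ℝ ∞ (fun y : V × FibreModel F =>
      h.form (c.φ.symm y.1) (c.lift (c.φ.symm y.1) y.2) (c.lift (c.φ.symm y.1) y.2))
      c.chart.target := by
  let b := Module.finBasis ℂ F
  have hs : ∀ i, ContDiff ℝ ∞
      (fun y : V × FibreModel F => b.coord i (c.ψ.symm ((1 : ℂ), y.2))) := by
    intro i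
    have h1 : ContDiff ℂ ∞ (fun y : V × FibreModel F => b.coord i (c.ψ.symm ((1 : ℂ), y.2))) :=
      (b.coord i).toContinuousLinearMap.contDiff.comp
        (c.ψ.symm.contDiff.comp (contDiff_const.prodMk contDiff_snd))
    exact h1.restrict_scalars ℝ
  have hconj : ContDiff ℝ ∞ (starRingEnd ℂ) := Complex.conjCLE.contDiff
  have hsum : ContDiffOn ℝ ∞ (fun y : V × FibreModel F => ∑ i, ∑ j,
      b.coord i (c.ψ.symm ((1 : ℂ), y.2)) *
        ((starRingEnd ℂ) (b.coord j (c.ψ.symm ((1 : ℂ), y.2))) *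
          h.form (c.φ.symm y.1) (c.e.symm (c.φ.symm y.1) (b i)) (c.e.symm (c.φ.symm y.1) (b j))))
      c.chart.target := by
    refine ContDiffOn.sum fun i _ => ContDiffOn.sum fun j _ => ?_
    refine (hs i).contDiffOn.mul ((hconj.comp (hs j)).contDiffOn.mul ?_)
    exact (h.contDiffOn_form c.φ c.φ_mem c.e (b i) (b j)).comp contDiff_fst.contDiffOn
      (fun y hy => hy)
  refine hsum.congr fun y hy => ?_
  have hx : c.φ.symm y.1 ∈ c.e.baseSet := hy.2
  have hl : c.lift (c.φ.symm y.1) y.2 =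
      ∑ i, b.coord i (c.ψ.symm ((1 : ℂ), y.2)) • c.e.symm (c.φ.symm y.1) (b i) := by
    unfold ChartIndex.lift
    simp only [← c.e.symmₗ_apply (R := ℂ) hx]
    conv_lhs => rw [← b.sum_repr (c.ψ.symm ((1 : ℂ), y.2))]
    rw [map_sum]
    simp only [map_smul, Module.Basis.coord_apply]
  rw [hl]
  simp only [map_sum, map_smul, LinearMap.map_smulₛₗ, LinearMap.smul_apply, smul_eq_mul,
    LinearMap.sum_apply, Finset.mul_sum]
  rw [Finset.sum_comm]
  refine Finset.sum_congr rfl fun i _ => Finset.sum_congr rfl fun j _ => ?_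
  ring

/-- The Hermitian metric that `h` induces on the tautological line bundle. -/
def taut (h : HermitianMetric V F E) :
    HermitianMetric (V × FibreModel F) ℂ (Taut V F E) where
  form := h.tautForm
  conj_form p v w := h.conj_form _ _ _
  form_pos p v hv := h.form_pos _ _ fun h0 => hv (Taut.incl_injective p (by rw [h0, map_zero]))
  contDiffOn_form := by
    intro f hf e he a b
    obtain ⟨c, hc⟩ := (ProjBundle.mem_atlas_iff f).1 hf
    obtain ⟨c', hc'⟩ := Taut.exists_chartIndex_of_mem e
    have htarget : f.target = c.chart.target := by rw [← hc]
    have hsymm : ∀ y, f.symm y = c.chart.symm y := by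
      intro y
      change f.toPartialEquiv.symm y = _
      rw [hc]
    have hbase : e.baseSet = c'.source := by
      change e.toPretrivialization.baseSet = _
      rw [hc']; rfl
    have hesymm : ∀ p ∈ c'.source, ∀ a, e.symm p a = a • c'.frame p := by
      intro p hp a
      change e.toPretrivialization.symm p a = _
      rw [hc']
      exact c'.pretriv_symm hp a
    have hS : f.target ∩ f.symm ⁻¹' e.baseSet ⊆ (c.chart.symm.trans c'.chart).source := by
      rintro y ⟨hy, hy'⟩
      rw [htarget] at hy
      rw [Set.mem_preimage, hbase, hsymm] at hy'
      exact ⟨hy, hy'⟩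
    have hS' : f.target ∩ f.symm ⁻¹' e.baseSet ⊆ c.transDomain c' := fun y hy => by
      have := hS hy
      rw [c.source_trans_eq] at this
      exact this.1.1
    have hS0 : ∀ y ∈ f.target ∩ f.symm ⁻¹' e.baseSet, (c.trans c' y).1 ≠ 0 := fun y hy => by
      have := hS hy
      rw [c.source_trans_eq] at this
      exact this.2
    have ht : ContDiffOn ℝ ∞ (fun y => (c.trans c' y).1⁻¹) (f.target ∩ f.symm ⁻¹' e.baseSet) :=
      ((((c.contDiffOn_trans c').fst.mono hS').inv hS0).restrict_scalars ℝ).of_le le_top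
    have hconj : ContDiff ℝ ∞ (starRingEnd ℂ) := Complex.conjCLE.contDiff
    have hh : ContDiffOn ℝ ∞ (fun y : V × FibreModel F =>
        h.form (c.φ.symm y.1) (c.lift (c.φ.symm y.1) y.2) (c.lift (c.φ.symm y.1) y.2))
        (f.target ∩ f.symm ⁻¹' e.baseSet) := by
      refine (h.contDiffOn_form_lift c).mono fun y hy => ?_
      exact (hS hy).1
    have hmain := (contDiffOn_const (c := a * (starRingEnd ℂ) b)).mul
      ((ht.mul (hconj.comp_contDiffOn ht)).mul hh)
    refine hmain.congr ?_
    intro y hy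
    have h1 := h.tautForm_frame c c' a b (hS hy).1 (hS hy).2
    have h2 := hsymm y
    rw [← h2] at h1
    have h3 : f.symm y ∈ c'.source := by rw [h2]; exact (hS hy).2
    rw [hesymm _ h3, hesymm _ h3]
    exact h1

end HermitianMetric

end Proj

end RCPositivity

end

/-! The statement is pointwise: over a line in `E_x`, the curvature of the tautological bundle along
the Chern-horizontal lift of `u` equals the curvature of `E` along `u`. A lift of a nonzero `u` is
nonzero, so a direction of positive curvature for `E` lifts to one for the tautological bundle.

In a standard chart the induced metric is, up to a constant factor, `K(z, w) = h_z(σ(w), σ(w))`,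
where `σ(w)` is the vector with homogeneous coordinates `(1, w)` (`taut_localForm`). Let `f` be the
coordinate vector of `v` in the frame of `E`, and let `Γ` represent the connection: `∂_u h(f, b) =
h(Γ, b)` for all `b` (`exists_connection`). In terms of `Γ` the curvature is `-∂_u ∂_ū h(f, f) +
h(Γ, Γ)` (`chernCurvature_eq`), with no inverse matrix left.

Choose `η` so that, up to the constant coordinate of `v`, `σ` moves along the line with direction
`(u, η)` as `f + tτ` with `τ + Γ = l f`; its covariant derivative is then a multiple of itself,
which is horizontality in `ℙ(E)`. Restricted to this line, `K` is a quadratic expression in `t` and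
its conjugate. Its first derivative is `l h(f, f)`, and its mixed derivative is `∂_u ∂_ū h(f, f) +
h(τ + Γ, τ + Γ) - h(Γ, Γ)`. The connection term of the line bundle is `|l|² h(f, f) = h(τ + Γ, τ +
Γ)`, so all dependence on `l` cancels and the curvature of `E` remains
(`exists_chernCurvature_taut_eq`). -/

noncomputable section

namespace RCPositivity

/-! ### Wirtinger calculus and restriction to complex lines. -/

section WirtingerCalculus

variable {V : Type*} [NormedAddCommGroup V] [NormedSpace ℂ V] {f g : V → ℂ} {u z : V}

lemma wirtinger_add (hf : DifferentiableAt ℝ f z) (hg : DifferentiableAt ℝ g z) :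
    wirtinger (fun y => f y + g y) u z = wirtinger f u z + wirtinger g u z := by
  simp only [wirtinger, fderiv_fun_add hf hg, add_apply]
  ring

lemma wirtingerBar_add (hf : DifferentiableAt ℝ f z) (hg : DifferentiableAt ℝ g z) :
    wirtingerBar (fun y => f y + g y) u z = wirtingerBar f u z + wirtingerBar g u z := by
  simp only [wirtingerBar, fderiv_fun_add hf hg, add_apply]
  ring

lemma wirtinger_mul (hf : DifferentiableAt ℝ f z) (hg : DifferentiableAt ℝ g z) :
    wirtinger (fun y => f y * g y) u z = f z * wirtinger g u z + g z * wirtinger f u z := by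
  simp only [wirtinger, fderiv_fun_mul hf hg, add_apply,
    smul_apply, smul_eq_mul]
  ring

lemma wirtingerBar_mul (hf : DifferentiableAt ℝ f z) (hg : DifferentiableAt ℝ g z) :
    wirtingerBar (fun y => f y * g y) u z = f z * wirtingerBar g u z + g z * wirtingerBar f u z := by
  simp only [wirtingerBar, fderiv_fun_mul hf hg, add_apply,
    smul_apply, smul_eq_mul]
  ring

lemma wirtinger_const_mul (c : ℂ) (hf : DifferentiableAt ℝ f z) :
    wirtinger (fun y => c * f y) u z = c * wirtinger f u z := by
  rw [wirtinger_mul (differentiableAt_const c) hf]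
  simp [wirtinger]

lemma wirtinger_congr (h : f =ᶠ[𝓝 z] g) : wirtinger f u z = wirtinger g u z := by
  simp only [wirtinger, h.fderiv_eq]

lemma wirtingerBar_congr (h : f =ᶠ[𝓝 z] g) : wirtingerBar f u z = wirtingerBar g u z := by
  simp only [wirtingerBar, h.fderiv_eq]

lemma eventuallyEq_wirtingerBar (h : f =ᶠ[𝓝 z] g) :
    wirtingerBar f u =ᶠ[𝓝 z] wirtingerBar g u :=
  h.eventuallyEq_nhds.mono fun _ hy => wirtingerBar_congr hy

/-- Conjugation is real linear, so it commutes with the real derivative, while it changes the sign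
of `I`. Combined with Hermitian symmetry this yields the conjugate derivatives of the metric from
the holomorphic ones. -/
lemma conj_wirtinger (f : V → ℂ) (u z : V) :
    (starRingEnd ℂ) (wirtinger f u z) =
      wirtingerBar (fun y => (starRingEnd ℂ) (f y)) u z := by
  have h : fderiv ℝ (fun y => (starRingEnd ℂ) (f y)) z =
      (Complex.conjCLE : ℂ →L[ℝ] ℂ).comp (fderiv ℝ f z) :=
    Complex.conjCLE.comp_fderiv (f := f) (x := z)
  simp only [wirtinger, wirtingerBar, h]
  simp [Complex.conj_ofNat]

lemma contDiffAt_wirtingerBar (hf : ContDiffAt ℝ ∞ f z) :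
    ContDiffAt ℝ ∞ (wirtingerBar f u) z := by
  have h : ContDiffAt ℝ ∞ (fderiv ℝ f) z := hf.fderiv_right le_rfl
  exact ((h.clm_apply contDiffAt_const).add
    (contDiffAt_const.mul (h.clm_apply contDiffAt_const))).div_const 2

lemma eventually_differentiableAt (hf : ContDiffAt ℝ ∞ f z) :
    ∀ᶠ y in 𝓝 z, DifferentiableAt ℝ f y :=
  -- Smoothness of order `∞` at a point need not persist at nearby points, since the neighbourhoods
  -- may shrink with the order; finite order does persist.
  ((hf.of_le (m := 1) (by simp)).eventually (by simp)).mono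
    fun _ hy => hy.differentiableAt one_ne_zero

/-- The line `t ↦ z + t • u` is holomorphic: its derivative sends `1` to `u` and `I` to `I • u`.
Hence Wirtinger derivatives along `u` become Wirtinger derivatives in the single variable `t`. -/
lemma fderiv_comp_line {t : ℂ} (hf : DifferentiableAt ℝ f (z + t • u)) (s : ℂ) :
    fderiv ℝ (fun t : ℂ => f (z + t • u)) t s = fderiv ℝ f (z + t • u) (s • u) := by
  have h : HasFDerivAt (fun t : ℂ => z + t • u)
      ((ContinuousLinearMap.toSpanSingleton ℂ u).restrictScalars ℝ) t :=
    (((ContinuousLinearMap.toSpanSingleton ℂ u).restrictScalars ℝ).hasFDerivAt).const_add z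
  have h2 := hf.hasFDerivAt.comp t h
  have h3 : fderiv ℝ (fun t : ℂ => f (z + t • u)) t = _ := h2.fderiv
  rw [h3]
  simp

lemma wirtinger_line {t : ℂ} (hf : DifferentiableAt ℝ f (z + t • u)) :
    wirtinger (fun t : ℂ => f (z + t • u)) 1 t = wirtinger f u (z + t • u) := by
  simp [wirtinger, fderiv_comp_line hf]

lemma wirtingerBar_line {t : ℂ} (hf : DifferentiableAt ℝ f (z + t • u)) :
    wirtingerBar (fun t : ℂ => f (z + t • u)) 1 t = wirtingerBar f u (z + t • u) := by
  simp [wirtingerBar, fderiv_comp_line hf]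

lemma tendsto_line (z u : V) : Filter.Tendsto (fun t : ℂ => z + t • u) (𝓝 0) (𝓝 z) := by
  have h : Continuous (fun t : ℂ => z + t • u) := by fun_prop
  simpa using h.tendsto 0

lemma contDiffAt_line (hf : ContDiffAt ℝ ∞ f z) :
    ContDiffAt ℝ ∞ (fun t : ℂ => f (z + t • u)) 0 := by
  have h : ContDiff ℝ ∞ (fun t : ℂ => z + t • u) :=
    contDiff_const.add
      ((ContinuousLinearMap.toSpanSingleton ℂ u).restrictScalars ℝ).contDiff
  exact ContDiffAt.comp (0 : ℂ) (g := f) (by simpa using hf) h.contDiffAt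

/-- The inner derivative is differentiated again, so its restriction formula is needed for all `t`
near `0`, not only at `0`. -/
lemma wirtinger_wirtingerBar_line (hf : ContDiffAt ℝ ∞ f z) :
    wirtinger (wirtingerBar (fun t : ℂ => f (z + t • u)) 1) 1 0 =
      wirtinger (wirtingerBar f u) u z := by
  have h1 : wirtingerBar (fun t : ℂ => f (z + t • u)) 1 =ᶠ[𝓝 0]
      fun t => wirtingerBar f u (z + t • u) :=
    ((tendsto_line z u).eventually (eventually_differentiableAt hf)).mono
      fun t ht => wirtingerBar_line ht
  rw [wirtinger_congr h1, wirtinger_line]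
  · simp
  · simpa using (contDiffAt_wirtingerBar hf).differentiableAt (by simp)

lemma wirtinger_id (t : ℂ) : wirtinger (fun t : ℂ => t) 1 t = 1 := by
  simp [wirtinger]

lemma wirtingerBar_id (t : ℂ) : wirtingerBar (fun t : ℂ => t) 1 t = 0 := by
  simp [wirtingerBar]

lemma fderiv_conj (t : ℂ) :
    fderiv ℝ (fun t : ℂ => (starRingEnd ℂ) t) t = (Complex.conjCLE : ℂ →L[ℝ] ℂ) :=
  Complex.conjCLE.hasFDerivAt.fderiv

lemma wirtinger_conj (t : ℂ) : wirtinger (fun t : ℂ => (starRingEnd ℂ) t) 1 t = 0 := by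
  simp [wirtinger, fderiv_conj]

lemma wirtingerBar_conj (t : ℂ) : wirtingerBar (fun t : ℂ => (starRingEnd ℂ) t) 1 t = 1 := by
  simp [wirtingerBar, fderiv_conj]

lemma differentiableAt_conj (t : ℂ) : DifferentiableAt ℝ (fun t : ℂ => (starRingEnd ℂ) t) t :=
  Complex.conjCLE.differentiableAt

/-! ### Quadratic expressions in `t` and its conjugate with smooth coefficients. -/

section Quadratic

variable {A B C D : ℂ → ℂ}

lemma wirtinger_quadratic (hA : ContDiffAt ℝ ∞ A 0) (hB : ContDiffAt ℝ ∞ B 0)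
    (hC : ContDiffAt ℝ ∞ C 0) (hD : ContDiffAt ℝ ∞ D 0) :
    wirtinger (fun t => A t + t * B t + (starRingEnd ℂ) t * (C t + t * D t)) 1 0 =
      wirtinger A 1 0 + B 0 := by
  have dA := hA.differentiableAt (by simp)
  have dB := hB.differentiableAt (by simp)
  have dC := hC.differentiableAt (by simp)
  have dD := hD.differentiableAt (by simp)
  have di : DifferentiableAt ℝ (fun t : ℂ => t) 0 := differentiableAt_fun_id
  have dc := differentiableAt_conj 0
  rw [wirtinger_add (dA.fun_add (di.fun_mul dB)) (dc.fun_mul (dC.fun_add (di.fun_mul dD))),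
    wirtinger_add dA (di.fun_mul dB), wirtinger_mul di dB,
    wirtinger_mul dc (dC.fun_add (di.fun_mul dD)), wirtinger_id, wirtinger_conj]
  simp

/-- At `t = 0` a term survives only if each explicit factor `t` has been removed by `∂` and each
conjugate factor by the conjugate derivative. The shape is that of `h(f + tτ, f + tτ)` after
expansion. -/
lemma wirtinger_wirtingerBar_quadratic (hA : ContDiffAt ℝ ∞ A 0) (hB : ContDiffAt ℝ ∞ B 0)
    (hC : ContDiffAt ℝ ∞ C 0) (hD : ContDiffAt ℝ ∞ D 0) :
    wirtinger (wirtingerBar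
        (fun t => A t + t * B t + (starRingEnd ℂ) t * (C t + t * D t)) 1) 1 0 =
      wirtinger (wirtingerBar A 1) 1 0 + wirtingerBar B 1 0 + wirtinger C 1 0 + D 0 := by
  have h1 : wirtingerBar (fun t => A t + t * B t + (starRingEnd ℂ) t * (C t + t * D t)) 1
      =ᶠ[𝓝 0] fun t => wirtingerBar A 1 t + t * wirtingerBar B 1 t + (C t + t * D t) +
        (starRingEnd ℂ) t * (wirtingerBar C 1 t + t * wirtingerBar D 1 t) := by
    filter_upwards [eventually_differentiableAt hA, eventually_differentiableAt hB,
      eventually_differentiableAt hC, eventually_differentiableAt hD] with t dA dB dC dD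
    have di : DifferentiableAt ℝ (fun t : ℂ => t) t := differentiableAt_fun_id
    have dc := differentiableAt_conj t
    rw [wirtingerBar_add (dA.fun_add (di.fun_mul dB)) (dc.fun_mul (dC.fun_add (di.fun_mul dD))),
      wirtingerBar_add dA (di.fun_mul dB), wirtingerBar_mul di dB,
      wirtingerBar_mul dc (dC.fun_add (di.fun_mul dD)), wirtingerBar_add dC (di.fun_mul dD),
      wirtingerBar_mul di dD, wirtingerBar_id, wirtingerBar_conj]
    ring
  have dA := (contDiffAt_wirtingerBar (u := 1) hA).differentiableAt (by simp)
  have dB := (contDiffAt_wirtingerBar (u := 1) hB).differentiableAt (by simp)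
  have dC := hC.differentiableAt (by simp)
  have dD := hD.differentiableAt (by simp)
  have dC' := (contDiffAt_wirtingerBar (u := 1) hC).differentiableAt (by simp)
  have dD' := (contDiffAt_wirtingerBar (u := 1) hD).differentiableAt (by simp)
  have di : DifferentiableAt ℝ (fun t : ℂ => t) 0 := differentiableAt_fun_id
  have dc := differentiableAt_conj 0
  rw [wirtinger_congr h1,
    wirtinger_add ((dA.fun_add (di.fun_mul dB)).fun_add (dC.fun_add (di.fun_mul dD)))
      (dc.fun_mul (dC'.fun_add (di.fun_mul dD'))),
    wirtinger_add (dA.fun_add (di.fun_mul dB)) (dC.fun_add (di.fun_mul dD)),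
    wirtinger_add dA (di.fun_mul dB), wirtinger_add dC (di.fun_mul dD), wirtinger_mul di dB,
    wirtinger_mul di dD, wirtinger_mul dc (dC'.fun_add (di.fun_mul dD')), wirtinger_id,
    wirtinger_conj]
  simp
  ring

end Quadratic

end WirtingerCalculus

/-! ### The metric in local coordinates as a sesquilinear form. -/

namespace HermitianMetric

variable {V : Type*} [NormedAddCommGroup V] [NormedSpace ℂ V]
    {X : Type*} [TopologicalSpace X] [ChartedSpace V X] [IsManifold 𝓘(ℂ, V) ω X]
    {F : Type*} [NormedAddCommGroup F] [NormedSpace ℂ F]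
    {E : X → Type*} [∀ x, AddCommGroup (E x)] [∀ x, Module ℂ (E x)]
    [TopologicalSpace (TotalSpace F E)] [∀ x, TopologicalSpace (E x)] [FiberBundle F E]
    [VectorBundle ℂ F E] [ContMDiffVectorBundle ω F E 𝓘(ℂ, V)]
    (h : HermitianMetric V F E) (x : X)

variable (V F E) in
/-- The coordinate domain on which the preferred chart and frame around `x` are both defined. -/
def localDomain : Set V :=
  (chartAt V x).target ∩ (chartAt V x).symm ⁻¹' (trivializationAt F E x).baseSet

lemma isOpen_localDomain : IsOpen (localDomain V F E x) :=
  (chartAt V x).isOpen_inter_preimage_symm (trivializationAt F E x).open_baseSet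

lemma mem_localDomain : chartAt V x x ∈ localDomain V F E x := by
  refine ⟨mem_chart_target V x, ?_⟩
  rw [Set.mem_preimage, (chartAt V x).left_inv (mem_chart_source V x)]
  exact FiberBundle.mem_baseSet_trivializationAt' x

lemma localDomain_mem_nhds : localDomain V F E x ∈ 𝓝 (chartAt V x x) :=
  (isOpen_localDomain x).mem_nhds (mem_localDomain x)

lemma contDiffAt_localForm (a b : F) :
    ContDiffAt ℝ ∞ (h.localForm x a b) (chartAt V x x) :=
  (h.contDiffOn_form (chartAt V x) (chart_mem_atlas V x) (trivializationAt F E x) a b).contDiffAt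
    (localDomain_mem_nhds x)

lemma differentiableAt_localForm (a b : F) :
    DifferentiableAt ℝ (h.localForm x a b) (chartAt V x x) :=
  (h.contDiffAt_localForm x a b).differentiableAt (by simp)

lemma conj_localForm (a b : F) (z : V) :
    (starRingEnd ℂ) (h.localForm x a b z) = h.localForm x b a z :=
  h.conj_form _ _ _

/-- `localForm` over a point of the coordinate domain, as a sesquilinear form. -/
def localSesq (z : V) : F →ₗ[ℂ] F →ₗ⋆[ℂ] ℂ :=
  LinearMap.mk₂'ₛₗ (RingHom.id ℂ) (starRingEnd ℂ)
    (fun a b => h.form ((chartAt V x).symm z)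
      ((trivializationAt F E x).symmₗ ℂ ((chartAt V x).symm z) a)
      ((trivializationAt F E x).symmₗ ℂ ((chartAt V x).symm z) b))
    (by intros; simp only [map_add, LinearMap.add_apply])
    (by intros; simp only [map_smul, LinearMap.smul_apply, RingHom.id_apply])
    (by intros; simp only [map_add])
    (by intros; simp only [map_smul, LinearMap.map_smulₛₗ])

variable {x}

/-- The bundled map `symmₗ` is linear at every point and agrees with `symm` over the base set; the
sesquilinearity rules for `localForm` are read off from this. -/
lemma localSesq_apply {z : V} (hz : z ∈ localDomain V F E x) (a b : F) :
    h.localSesq x z a b = h.localForm x a b z := by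
  simp only [localSesq, localForm, LinearMap.mk₂'ₛₗ_apply]
  rw [Trivialization.symmₗ_apply _ hz.2, Trivialization.symmₗ_apply _ hz.2]

lemma localForm_add_left {z : V} (hz : z ∈ localDomain V F E x) (a a' b : F) :
    h.localForm x (a + a') b z = h.localForm x a b z + h.localForm x a' b z := by
  simp only [← h.localSesq_apply hz, map_add, LinearMap.add_apply]

lemma localForm_add_right {z : V} (hz : z ∈ localDomain V F E x) (a b b' : F) :
    h.localForm x a (b + b') z = h.localForm x a b z + h.localForm x a b' z := by
  simp only [← h.localSesq_apply hz, map_add]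

lemma localForm_smul_left {z : V} (hz : z ∈ localDomain V F E x) (c : ℂ) (a b : F) :
    h.localForm x (c • a) b z = c * h.localForm x a b z := by
  simp only [← h.localSesq_apply hz, map_smul, LinearMap.smul_apply, smul_eq_mul]

lemma localForm_smul_right {z : V} (hz : z ∈ localDomain V F E x) (c : ℂ) (a b : F) :
    h.localForm x a (c • b) z = (starRingEnd ℂ) c * h.localForm x a b z := by
  simp only [← h.localSesq_apply hz, LinearMap.map_smulₛₗ, smul_eq_mul]

lemma localForm_self_ne_zero {z : V} (hz : z ∈ localDomain V F E x) {a : F} (ha : a ≠ 0) :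
    h.localForm x a a z ≠ 0 := by
  have h1 : (trivializationAt F E x).symm ((chartAt V x).symm z) a ≠ 0 := by
    intro h0
    apply ha
    have h2 := (trivializationAt F E x).linearMapAt_symmₗ (R := ℂ) hz.2 a
    rwa [Trivialization.symmₗ_apply _ hz.2, h0, map_zero, eq_comm] at h2
  intro h0
  have h3 := h.form_pos _ _ h1
  rw [localForm] at h0
  rw [h0] at h3
  simp at h3

lemma conj_wirtinger_localForm (a b : F) (u z : V) :
    (starRingEnd ℂ) (wirtinger (h.localForm x a b) u z) =
      wirtingerBar (h.localForm x b a) u z := by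
  rw [conj_wirtinger]
  simp only [conj_localForm]

lemma wirtinger_localForm_smul_right (c : ℂ) (a b : F) (u : V) :
    wirtinger (h.localForm x a (c • b)) u (chartAt V x x) =
      (starRingEnd ℂ) c * wirtinger (h.localForm x a b) u (chartAt V x x) := by
  rw [← wirtinger_const_mul _ (h.differentiableAt_localForm x a b)]
  exact wirtinger_congr (Filter.eventuallyEq_of_mem (localDomain_mem_nhds x)
    fun z hz => h.localForm_smul_right hz c a b)

lemma wirtinger_localForm_add_right (a b b' : F) (u : V) :
    wirtinger (h.localForm x a (b + b')) u (chartAt V x x) =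
      wirtinger (h.localForm x a b) u (chartAt V x x) +
        wirtinger (h.localForm x a b') u (chartAt V x x) := by
  rw [← wirtinger_add (h.differentiableAt_localForm x a b) (h.differentiableAt_localForm x a b')]
  exact wirtinger_congr (Filter.eventuallyEq_of_mem (localDomain_mem_nhds x)
    fun z hz => h.localForm_add_right hz a b b')

variable (x) in
/-- The conjugate linear form `b ↦ ∂_u h(a, b)` at `x`. -/
def wirtingerForm (a : F) (u : V) : F →ₗ⋆[ℂ] ℂ where
  toFun b := wirtinger (h.localForm x a b) u (chartAt V x x)
  map_add' b b' := h.wirtinger_localForm_add_right a b b' u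
  map_smul' c b := h.wirtinger_localForm_smul_right c a b u

/-! ### The Chern connection and the curvature expressed through it. -/

variable [FiniteDimensional ℂ F]

/-- A row vector killed by the Gram matrix gives a combination of basis vectors orthogonal to the
whole basis, hence to itself; positivity forces it to vanish. -/
lemma isUnit_det_gramMatrix (x : X) : IsUnit (h.gramMatrix x).det := by
  rw [isUnit_iff_ne_zero]
  intro h0
  obtain ⟨c, hc, hc'⟩ := Matrix.exists_vecMul_eq_zero_iff.2 h0
  let b := Module.finBasis ℂ F
  have h1 : ∀ β, h.localSesq x (chartAt V x x) (∑ α, c α • b α) (b β) = 0 := by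
    intro β
    have h2 := congrFun hc' β
    simp only [map_sum, map_smul, LinearMap.sum_apply, LinearMap.smul_apply, smul_eq_mul,
      h.localSesq_apply (mem_localDomain x)]
    exact h2
  have h2 : h.localSesq x (chartAt V x x) (∑ α, c α • b α) = 0 := b.ext h1
  by_cases h3 : ∑ α, c α • b α = 0
  · exact hc (funext fun α => Fintype.linearIndependent_iff.1 b.linearIndependent c h3 α)
  · apply h.localForm_self_ne_zero (mem_localDomain x) h3
    rw [← h.localSesq_apply (mem_localDomain x), h2]
    rfl

/-- The Chern connection: the form `b ↦ ∂_u h(a, b)` is represented by a vector. -/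
lemma exists_connection (x : X) (a : F) (u : V) : ∃ Γ : F, ∀ b : F,
    wirtinger (h.localForm x a b) u (chartAt V x x) = h.localForm x Γ b (chartAt V x x) := by
  let b := Module.finBasis ℂ F
  let r : Fin (Module.finrank ℂ F) → ℂ := fun δ => h.wirtingerForm x a u (b δ)
  -- Pairing `∑ c α • b α` with `b β` gives the entry `β` of the row vector `c` times the Gram
  -- matrix, so the inverse acts from the right.
  let c := Matrix.vecMul r (h.gramMatrix x)⁻¹
  have hc : Matrix.vecMul c (h.gramMatrix x) = r := by
    rw [Matrix.vecMul_vecMul, Matrix.nonsing_inv_mul _ (h.isUnit_det_gramMatrix x),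
      Matrix.vecMul_one]
  refine ⟨∑ α, c α • b α, fun v => ?_⟩
  rw [← h.localSesq_apply (mem_localDomain x)]
  have key : h.wirtingerForm x a u = h.localSesq x (chartAt V x x) (∑ α, c α • b α) := by
    refine b.ext fun β => ?_
    simp only [map_sum, map_smul, LinearMap.sum_apply, LinearMap.smul_apply, smul_eq_mul,
        h.localSesq_apply (mem_localDomain x)]
    exact (congrFun hc β).symm
  exact LinearMap.congr_fun key v

/-- The factors of the first-order term are `h(Γ, b δ)` and, by conjugation, `h(b γ, Γ)`.
Contracting the former with the inverse Gram matrix recovers the coordinates of `Γ`, so the double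
sum collapses to `h(Γ, Γ)`. -/
lemma chernCurvature_eq (x : X) (u : V) (v : E x) {Γ : F}
    (hΓ : ∀ b : F, wirtinger (h.localForm x (trivializationAt F E x ⟨x, v⟩).2 b) u
      (chartAt V x x) = h.localForm x Γ b (chartAt V x x)) :
    h.chernCurvature x u u v v =
      -wirtinger (wirtingerBar (h.localForm x (trivializationAt F E x ⟨x, v⟩).2
        (trivializationAt F E x ⟨x, v⟩).2) u) u (chartAt V x x) +
      h.localForm x Γ Γ (chartAt V x x) := by
  let b := Module.finBasis ℂ F
  have hb : ∀ γ, wirtingerBar (h.localForm x (b γ) (trivializationAt F E x ⟨x, v⟩).2) u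
      (chartAt V x x) = h.localForm x (b γ) Γ (chartAt V x x) := by
    intro γ
    rw [← h.conj_wirtinger_localForm, hΓ, h.conj_localForm]
  have hr : (fun δ => h.localForm x Γ (b δ) (chartAt V x x)) =
      Matrix.vecMul (b.repr Γ) (h.gramMatrix x) := by
    funext δ
    conv_lhs => rw [← b.sum_repr Γ, ← h.localSesq_apply (mem_localDomain x)]
    simp only [map_sum, map_smul, LinearMap.sum_apply, LinearMap.smul_apply, smul_eq_mul,
      h.localSesq_apply (mem_localDomain x)]
    rfl
  have hr' : Matrix.vecMul (fun δ => h.localForm x Γ (b δ) (chartAt V x x))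
      (h.gramMatrix x)⁻¹ = b.repr Γ := by
    rw [hr, Matrix.vecMul_vecMul, Matrix.mul_nonsing_inv _ (h.isUnit_det_gramMatrix x),
      Matrix.vecMul_one]
  simp only [chernCurvature]
  congr 1
  change (∑ γ, ∑ δ, (h.gramMatrix x)⁻¹ δ γ *
    wirtinger (h.localForm x (trivializationAt F E x ⟨x, v⟩).2 (b δ)) u (chartAt V x x) *
    wirtingerBar (h.localForm x (b γ) (trivializationAt F E x ⟨x, v⟩).2) u (chartAt V x x)) = _
  have h1 : h.localForm x Γ Γ (chartAt V x x) =
      ∑ γ, b.repr Γ γ * h.localForm x (b γ) Γ (chartAt V x x) := by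
    simp only [← h.localSesq_apply (mem_localDomain x)]
    have h2 := LinearMap.congr_fun
      (congrArg (h.localSesq x (chartAt V x x)) (b.sum_repr Γ)) Γ
    rw [← h2]
    simp only [map_sum, map_smul, LinearMap.sum_apply, LinearMap.smul_apply, smul_eq_mul]
  rw [h1]
  refine Finset.sum_congr rfl fun γ _ => ?_
  rw [← hr', Matrix.vecMul, dotProduct, Finset.sum_mul]
  refine Finset.sum_congr rfl fun δ _ => ?_
  rw [hΓ, hb]
  ring

end HermitianMetric

/-! ### The tautological bundle in the preferred charts. -/

section ProjBundle

variable {V : Type*} [NormedAddCommGroup V] [NormedSpace ℂ V]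
    {X : Type*} [TopologicalSpace X] [ChartedSpace V X]
    {F : Type*} [NormedAddCommGroup F] [NormedSpace ℂ F]
    {E : X → Type*} [∀ x, AddCommGroup (E x)] [∀ x, Module ℂ (E x)]
    [TopologicalSpace (TotalSpace F E)] [∀ x, TopologicalSpace (E x)] [FiberBundle F E]
    [VectorBundle ℂ F E] [FiniteDimensional ℂ F]

/-- Each Chern curvature is computed in preferred coordinates. This and the next lemma make those of
`ℙ(E)` at `p` compatible with those of `X` and `E` at `p.base`, so that the two curvatures can be
compared directly. -/
lemma ProjBundle.chartIndexAt_φ (p : ProjBundle V F E) :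
    p.chartIndexAt.φ = chartAt V p.base :=
  p.exists_chartIndex.choose_spec.1

lemma ProjBundle.chartIndexAt_e (p : ProjBundle V F E) :
    p.chartIndexAt.e = trivializationAt F E p.base :=
  p.exists_chartIndex.choose_spec.2.1

/-- The local section `w ↦ (1, w)` of the line bundle, in the frame of `E` around `p.base`. -/
def ProjBundle.localLift (p : ProjBundle V F E) (w : FibreModel F) : F :=
  p.chartIndexAt.ψ.symm (1, w)

variable [IsManifold 𝓘(ℂ, V) ω X] [ContMDiffVectorBundle ω F E 𝓘(ℂ, V)]

lemma ProjBundle.chartAt_apply_self (p : ProjBundle V F E) :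
    chartAt (V × FibreModel F) p p = (chartAt V p.base p.base, p.chartIndexAt.affine p) := by
  change (p.chartIndexAt.φ p.base, p.chartIndexAt.affine p) = _
  rw [p.chartIndexAt_φ]

lemma Taut.trivializationAt_symm (p : ProjBundle V F E) {q : ProjBundle V F E}
    (hq : q ∈ p.chartIndexAt.source) (a : ℂ) :
    (trivializationAt ℂ (Taut V F E) p).symm q a = a • p.chartIndexAt.frame q :=
  p.chartIndexAt.pretriv_symm hq a

/-- The coordinate of a vector of the tautological line bundle in the preferred trivialization
determines its coordinates as a vector of `E`. -/
lemma Taut.trivializationAt_incl (p : ProjBundle V F E) (v : Taut V F E p) :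
    (trivializationAt F E p.base ⟨p.base, Taut.incl p v⟩).2 =
      (trivializationAt ℂ (Taut V F E) p ⟨p, v⟩).2 • p.localLift (p.chartIndexAt.affine p) := by
  have hp := p.mem_source_chartIndexAt
  have h1 : (trivializationAt ℂ (Taut V F E) p ⟨p, v⟩).2 =
      (p.chartIndexAt.hom p.base (Taut.incl p v)).1 := rfl
  have h2 : (trivializationAt F E p.base ⟨p.base, Taut.incl p v⟩).2 =
      p.chartIndexAt.ψ.symm (p.chartIndexAt.hom p.base (Taut.incl p v)) := by
    have h3 : (p.chartIndexAt.e ⟨p.base, Taut.incl p v⟩).2 =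
        p.chartIndexAt.ψ.symm (p.chartIndexAt.hom p.base (Taut.incl p v)) := by
      simp only [ChartIndex.hom, LinearMap.comp_apply]
      rw [Trivialization.linearMapAt_apply, if_pos hp.2.1]
      exact (p.chartIndexAt.ψ.symm_apply_apply _).symm
    rw [← h3, p.chartIndexAt_e]
  rw [h1, h2]
  conv_lhs => rw [p.chartIndexAt.eq_smul_frame hp v]
  rw [map_smul, map_smul, p.chartIndexAt.hom_incl_frame hp, map_smul]
  rfl

/-! ### Comparison of the two curvatures in the horizontal direction. -/

namespace HermitianMetric

variable (h : HermitianMetric V F E)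

/-- The constant section `1` of the line bundle is the frame vector with `W₀ = 1`, that is,
`localLift` read in the frame of `E`. -/
lemma taut_localForm (p : ProjBundle V F E) (a b : ℂ) {y : V × FibreModel F}
    (hy : y.1 ∈ localDomain V F E p.base) :
    h.taut.localForm p a b y = a * (starRingEnd ℂ) b *
      h.localForm p.base (p.localLift y.2) (p.localLift y.2) y.1 := by
  have hy1 : y ∈ p.chartIndexAt.chart.target := by
    refine ⟨?_, ?_⟩
    · rw [p.chartIndexAt_φ]; exact hy.1
    · rw [p.chartIndexAt_φ, p.chartIndexAt_e]; exact hy.2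
  have hy2 : p.chartIndexAt.chart.symm y ∈ p.chartIndexAt.source :=
    p.chartIndexAt.chart.map_target hy1
  have h1 := h.tautForm_frame p.chartIndexAt p.chartIndexAt a b hy1 hy2
  -- The transition from the chart to itself has `W₀ = 1`, so the rescaling factors in
  -- `tautForm_frame` are trivial.
  rw [← p.chartIndexAt.hom_lift_eq_trans p.chartIndexAt ⟨hy1.2, hy1.2⟩,
    p.chartIndexAt.hom_lift hy1.2] at h1
  have h2 : h.taut.localForm p a b y = h.tautForm (p.chartIndexAt.chart.symm y)
      (a • p.chartIndexAt.frame _) (b • p.chartIndexAt.frame _) := by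
    rw [← Taut.trivializationAt_symm p hy2, ← Taut.trivializationAt_symm p hy2]
    rfl
  rw [h2, h1]
  simp only [inv_one, map_one, one_mul, ChartIndex.lift, localForm, ProjBundle.localLift,
    p.chartIndexAt_e]
  rw [p.chartIndexAt_φ]

lemma localForm_add_smul {x : X} {z : V} (hz : z ∈ localDomain V F E x) (f g : F) (t : ℂ) :
    h.localForm x (f + t • g) (f + t • g) z = h.localForm x f f z + t * h.localForm x g f z +
      (starRingEnd ℂ) t * (h.localForm x f g z + t * h.localForm x g g z) := by
  simp only [h.localForm_add_left hz, h.localForm_add_right hz, h.localForm_smul_left hz,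
    h.localForm_smul_right hz]
  ring

/-- In the direction `(u, η)` that lifts `u` horizontally with respect to the Chern connection of
`E`, the curvature of the tautological line bundle is the curvature of `E`. -/
lemma exists_chernCurvature_taut_eq (p : ProjBundle V F E) (u : V) (v : Taut V F E p)
    (hv : v ≠ 0) : ∃ η : FibreModel F,
    h.taut.chernCurvature p ((u, η) : V × FibreModel F) ((u, η) : V × FibreModel F) v v =
      h.chernCurvature p.base u u (Taut.incl p v) (Taut.incl p v) := by
  set x := p.base with hx
  set z₀ : V := chartAt V x x with hz₀
  set w₀ := p.chartIndexAt.affine p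
  set a : ℂ := (trivializationAt ℂ (Taut V F E) p ⟨p, v⟩).2 with ha
  set f : F := (trivializationAt F E x ⟨x, Taut.incl p v⟩).2 with hf
  have hfa : f = a • p.localLift w₀ := Taut.trivializationAt_incl p v
  -- `a` is the coordinate `W₀` of `v`, and `v` is `a` times the frame vector.
  have ha0 : a ≠ 0 := fun h0 => hv <| by
    have h1 := p.chartIndexAt.eq_smul_frame p.mem_source_chartIndexAt v
    rw [h1]
    change a • _ = _
    rw [h0, zero_smul]
  obtain ⟨Γ, hΓ⟩ := h.exists_connection x f u
  let ψ := p.chartIndexAt.ψ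
  -- Horizontality up to multiples of `f` means `τ = -Γ + l • f`. The lifts all have `W₀ = 1`, so
  -- `τ` must have `W₀`-coordinate `0`; as `f` has `W₀`-coordinate `a`, this determines `l`. Then
  -- `η` is `1 / a` times the remaining coordinates of `τ`.
  let l : ℂ := (ψ Γ).1 / a
  let η : FibreModel F := a⁻¹ • (-(ψ Γ).2) + l • w₀
  let τ : F := -Γ + l • f
  have hτ : ∀ t : ℂ, a • p.localLift (w₀ + t • η) = f + t • τ := by
    intro t
    apply ψ.injective
    rw [hfa]
    simp only [ProjBundle.localLift, τ, hfa, map_add, map_smul, map_neg]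
    simp only [ψ, ContinuousLinearEquiv.apply_symm_apply]
    ext1
    · simp [l, ψ, div_mul_cancel₀ _ ha0]
    · simp only [η, ψ, Prod.smul_snd, Prod.snd_add, Prod.snd_neg, smul_add, smul_smul, smul_neg]
      congr 2
      · rw [mul_comm a, mul_assoc, inv_mul_cancel₀ ha0, mul_one]
      · ring_nf
  refine ⟨η, ?_⟩
  let U : V × FibreModel F := (u, η)
  let y₀ : V × FibreModel F := chartAt (V × FibreModel F) p p
  have hy₀ : y₀ = (z₀, w₀) := p.chartAt_apply_self
  have hmem : z₀ ∈ localDomain V F E x := mem_localDomain x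
  have hK : ContDiffAt ℝ ∞ (h.taut.localForm p a a) y₀ := h.taut.contDiffAt_localForm p a a
  have hH : ∀ b c, ContDiffAt ℝ ∞ (h.localForm x b c) z₀ := fun b c => h.contDiffAt_localForm x b c
  have hL : ∀ b c, ContDiffAt ℝ ∞ (fun t : ℂ => h.localForm x b c (z₀ + t • u)) 0 :=
    fun b c => contDiffAt_line (hH b c)
  have hd : ∀ b c, DifferentiableAt ℝ (h.localForm x b c) (z₀ + (0 : ℂ) • u) := fun b c => by
    simpa using (hH b c).differentiableAt (by simp)
  -- By `hτ` the metric along the line is `h(f + tτ, f + tτ)` over `z₀ + t • u`; sesquilinearity is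
  -- available only while this point stays in the coordinate domain.
  have hline : (fun t : ℂ => h.taut.localForm p a a (y₀ + t • U)) =ᶠ[𝓝 0] fun t =>
      h.localForm x f f (z₀ + t • u) + t * h.localForm x τ f (z₀ + t • u) +
      (starRingEnd ℂ) t * (h.localForm x f τ (z₀ + t • u) +
        t * h.localForm x τ τ (z₀ + t • u)) := by
    filter_upwards [(tendsto_line z₀ u).eventually (localDomain_mem_nhds (F := F) (E := E) x)]
      with t ht
    have h1 : y₀ + t • U = (z₀ + t • u, w₀ + t • η) := by rw [hy₀]; rfl
    rw [h1, h.taut_localForm p a a (y := (z₀ + t • u, w₀ + t • η)) ht, ← h.localForm_add_smul ht, ← hτ,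
      h.localForm_smul_left ht, h.localForm_smul_right ht]
    ring
  have h_value : h.taut.localForm p a a y₀ = h.localForm x f f z₀ := by
    simpa using hline.self_of_nhds
  -- The derivative is `h(Γ, f) + h(τ, f)`, and `Γ + τ = l • f`.
  have h_first : wirtinger (h.taut.localForm p a a) U y₀ = l * h.localForm x f f z₀ := by
    have h1 := wirtinger_line (f := h.taut.localForm p a a) (z := y₀) (u := U) (t := 0)
      (by simpa using hK.differentiableAt (by simp))
    rw [zero_smul, add_zero, wirtinger_congr hline,
      wirtinger_quadratic (hL _ _) (hL _ _) (hL _ _) (hL _ _), wirtinger_line (hd _ _)] at h1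
    rw [← h1]
    simp only [zero_smul, add_zero]
    rw [hΓ, ← h.localForm_add_left hmem, ← h.localForm_smul_left hmem]
    simp [τ]
  -- The cross terms are the conjugate derivative of `h(τ, f)`, equal to `h(τ, Γ)` by conjugating
  -- the defining property of `Γ`, and the derivative of `h(f, τ)`, equal to `h(Γ, τ)`.
  have h_second : wirtinger (wirtingerBar (h.taut.localForm p a a) U) U y₀ =
      wirtinger (wirtingerBar (h.localForm x f f) u) u z₀ + h.localForm x τ Γ z₀ +
        h.localForm x Γ τ z₀ + h.localForm x τ τ z₀ := by
    rw [← wirtinger_wirtingerBar_line hK, wirtinger_congr (eventuallyEq_wirtingerBar hline),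
      wirtinger_wirtingerBar_quadratic (hL _ _) (hL _ _) (hL _ _) (hL _ _),
      wirtinger_wirtingerBar_line (hH _ _), wirtinger_line (hd _ _), wirtingerBar_line (hd _ _)]
    simp only [zero_smul, add_zero]
    rw [hΓ, ← h.conj_wirtinger_localForm, hΓ, h.conj_localForm]
  -- The connection vector of the line bundle is `l * a`. The model fibre is spanned by `a`, so
  -- conjugate linearity reduces every `b` to `b = a`, which is `h_first`.
  have hΓ' : ∀ b : ℂ, wirtinger (h.taut.localForm p a b) U y₀ =
      h.taut.localForm p (l * a) b y₀ := by
    intro b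
    have hmem' : y₀ ∈ localDomain (V × FibreModel F) ℂ (Taut V F E) p := mem_localDomain p
    have hb : b = (b / a) • a := by rw [smul_eq_mul, div_mul_cancel₀ _ ha0]
    rw [hb, h.taut.wirtinger_localForm_smul_right, h.taut.localForm_smul_right hmem',
      ← smul_eq_mul l a, h.taut.localForm_smul_left hmem', h_value]
    congr 1
  have hmem' : y₀ ∈ localDomain (V × FibreModel F) ℂ (Taut V F E) p := mem_localDomain p
  have e1 := h.taut.chernCurvature_eq p U v hΓ'
  have e2 := h.chernCurvature_eq x u (Taut.incl p v) hΓ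
  change h.taut.chernCurvature p U U v v = _
  rw [e1, e2]
  change -wirtinger (wirtingerBar (h.taut.localForm p a a) U) U y₀ +
    h.taut.localForm p (l * a) (l * a) y₀ =
    -wirtinger (wirtingerBar (h.localForm x f f) u) u z₀ + h.localForm x Γ Γ z₀
  -- Completing the square: expanding the left side gives the three extra terms of `h_second` plus
  -- `h(Γ, Γ)`, while the right side is the connection term of the line bundle.
  have h_sq : h.localForm x (τ + Γ) (τ + Γ) z₀ = l * ((starRingEnd ℂ) l * h.localForm x f f z₀) := by
    have h1 : τ + Γ = l • f := by simp [τ]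
    rw [h1, h.localForm_smul_left hmem, h.localForm_smul_right hmem]
  simp only [h.localForm_add_left hmem, h.localForm_add_right hmem] at h_sq
  rw [h_second, ← smul_eq_mul l a, h.taut.localForm_smul_left hmem',
    h.taut.localForm_smul_right hmem', h_value]
  linear_combination -h_sq

end HermitianMetric

end ProjBundle

end RCPositivity

end

theorem proposition2p6
    {V : Type*} [NormedAddCommGroup V] [NormedSpace ℂ V] [FiniteDimensional ℂ V]
    {X : Type*} [TopologicalSpace X] [T2Space X] [CompactSpace X] [ChartedSpace V X]
    [IsManifold 𝓘(ℂ, V) ω X]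
    {F : Type*} [NormedAddCommGroup F] [NormedSpace ℂ F] [FiniteDimensional ℂ F]
    (E : X → Type*) [∀ x, AddCommGroup (E x)] [∀ x, Module ℂ (E x)]
    [TopologicalSpace (TotalSpace F E)] [∀ x, TopologicalSpace (E x)] [FiberBundle F E]
    [VectorBundle ℂ F E] [ContMDiffVectorBundle ω F E 𝓘(ℂ, V)]
    (h : RCPositivity.HermitianMetric V F E) (hE : h.IsRCPositive) :
    (h.taut : RCPositivity.HermitianMetric (V × RCPositivity.FibreModel F) ℂ
      (RCPositivity.Taut V F E)).IsRCPositive := by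
  intro p v hv
  have hv' : RCPositivity.Taut.incl p v ≠ 0 := fun h0 =>
    hv (RCPositivity.Taut.incl_injective p (by rw [h0, map_zero]))
  obtain ⟨u, hu, hpos⟩ := hE p.base (RCPositivity.Taut.incl p v) hv'
  obtain ⟨η, hη⟩ := h.exists_chernCurvature_taut_eq p u v hv
  -- The lift is nonzero because it projects to `u`, whatever `η` is.
  refine ⟨((u, η) : V × RCPositivity.FibreModel F), fun h0 => hu (congrArg Prod.fst h0), ?_⟩
  rw [hη]
  exact hpos
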